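/- Let $(\Omega,\mathcal F,\mathbb P)$ be a probability space, and let $\xi\ge 0$ be a random variable with $\mathbb E[\xi]=1$ (the density of the pricing measure) whose law has no atom. Write $F_\xi(x)=\mathbb P(\xi\le x)$, $\alpha(c)=\mathbb P(\xi>c)$ and $\overline\xi=\operatorname{ess\,sup}\xi\in(0,+\infty]$; for a real random variable $X$ let $F_X^{-1}(u)=\inf\{x\in\mathbb R: F_X(x)\ge u\}$, with $\inf\emptyset=+\infty$. Let $\mu$ be a probability measure on $(0,1]$, and let $$\rho_\mu(X)=\int_{(0,1]}\mathrm{CVaR}_\beta(X)\,\mu(d\beta),\qquad \mathrm{CVaR}_\beta(X)=-\frac1\beta\int_0^\beta F_X^{-1}(u)\,du,\qquad \phi(x)=\int_{(x,1]}\frac{\mu(ds)}{s},$$ be the spectral risk measure of $\mu$ (with values in the extended reals) and its spectrum. Fix $\rho_0>0$. For $A\in\mathcal F$ let $$\Delta(A)=\inf\bigl\{\mathbb E[\xi Y] : Y\in L^1(\xi\mathbb P),\ \rho_\mu(Y)\le\rho_0,\ Y=0 \text{ on } A,\ Y\le 0\text{ on }A^c\bigr\}\in[-\infty,0],$$ and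 $\Delta(c)=\Delta(\{\xi\le c\})$. For $z>0$ let $$R(z)=\frac{\mathbb E\left[\xi\mathbf 1_{\{1-F_\xi(\xi)<z\}}\right]}{\int_0^z\phi(u)\,du},$$ and let $R(0)=\limsup_{z\to0^+}R(z)\in[0,+\infty]$ (the limit of $R$ at $0^+$ whenever it exists). (i) For every real $c<\overline\xi$, the function $R$ attains its maximum over $[0,\alpha(c)]$, as a function with values in $[0,+\infty]$, and $$\Delta(c)=-\rho_0\max_{0\le z\le\alpha(c)}R(z).$$ (ii) If the limit $L=\lim_{x\to0^+}F_\xi^{-1}(1-x)/\phi(x)$ exists in $[0,+\infty]$, then $$\lim_{c\uparrow\overline\xi}\Delta(c)=-\rho_0 L .$$ -/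

import Mathlib

open MeasureTheory Filter Topology Set
open scoped ENNReal

noncomputable section

namespace SpectralPortfolio

/-- The distribution function `F_X(x) = P(X ≤ x)`. -/
def distFun {Ω : Type*} [MeasurableSpace Ω] (P : Measure Ω) (X : Ω → ℝ) (x : ℝ) : ℝ :=
  P.real {ω | X ω ≤ x}

/-- The generalized inverse `F_X⁻¹(u) = inf {x ∈ ℝ : F_X(x) ≥ u}`, as an extended real
(so that `inf ∅ = +∞`). -/
def quantile {Ω : Type*} [MeasurableSpace Ω] (P : Measure Ω) (X : Ω → ℝ) (u : ℝ) : EReal :=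
  ⨅ x ∈ {x : ℝ | u ≤ distFun P X x}, (x : EReal)

/-- The value at risk `VaR_u(X) = -F_X⁻¹(u)`. -/
def VaR {Ω : Type*} [MeasurableSpace Ω] (P : Measure Ω) (X : Ω → ℝ) (u : ℝ) : EReal :=
  -quantile P X u

/-- The extended integral `∫ f⁺ dν - ∫ f⁻ dν` of an extended-real function; it is `+∞` as soon as
`∫ f⁺ dν = +∞`. -/
def extIntegral {α : Type*} [MeasurableSpace α] (ν : Measure α) (f : α → EReal) : EReal :=
  if ∫⁻ a, (f a).toENNReal ∂ν = ⊤ then ⊤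
  else ((∫⁻ a, (f a).toENNReal ∂ν : ℝ≥0∞) : EReal) - ((∫⁻ a, (-f a).toENNReal ∂ν : ℝ≥0∞) : EReal)

/-- `CVaR_β(X) = (1/β) ∫₀^β VaR_u(X) du`, for `0 < β ≤ 1`. -/
def CVaR {Ω : Type*} [MeasurableSpace Ω] (P : Measure Ω) (β : ℝ) (X : Ω → ℝ) : EReal :=
  ((1 / β : ℝ) : EReal) * extIntegral (volume.restrict (Ioc 0 β)) (VaR P X)

/-- The spectral risk measure `ρ_μ(X) = ∫ CVaR_u(X) μ(du)`, for a probability measure `μ`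
carried by `(0,1]`. -/
def spectralRisk {Ω : Type*} [MeasurableSpace Ω] (P : Measure Ω) (μ : Measure ℝ) (X : Ω → ℝ) :
    EReal :=
  extIntegral (μ.restrict (Ioc 0 1)) (fun u => CVaR P u X)

/-- The spectrum `φ(x) = ∫_{(x,1]} μ(ds)/s`. -/
def spectrumFun (μ : Measure ℝ) (x : ℝ) : ℝ≥0∞ :=
  ∫⁻ s in Ioc x 1, ENNReal.ofReal (1 / s) ∂μ

/-- The feasible set `H₂(A)` for a risk measure `ρ`, a risk tolerance `ρ₀` and a density `ξ`:
all `Y ∈ L¹(ξP)` with `ρ(Y) ≤ ρ₀`, `Y = 0` on `A`, and `Y ≤ 0` on `Aᶜ`. -/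
def lossSet {Ω : Type*} [MeasurableSpace Ω] (P : Measure Ω) (ξ : Ω → ℝ)
    (ρ : (Ω → ℝ) → EReal) (ρ₀ : ℝ) (A : Set Ω) : Set (Ω → ℝ) :=
  {Y | Integrable Y (P.withDensity fun ω => ENNReal.ofReal (ξ ω)) ∧
    ρ Y ≤ (ρ₀ : EReal) ∧
    (∀ᵐ ω ∂P, ω ∈ A → Y ω = 0) ∧ (∀ᵐ ω ∂P, ω ∉ A → Y ω ≤ 0)}

/-- `Δ(A) = inf {E[ξY] : Y ∈ H₂(A)}`, an infimum in the extended reals. -/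
def minCost {Ω : Type*} [MeasurableSpace Ω] (P : Measure Ω) (ξ : Ω → ℝ)
    (ρ : (Ω → ℝ) → EReal) (ρ₀ : ℝ) (A : Set Ω) : EReal :=
  ⨅ Y ∈ lossSet P ξ ρ ρ₀ A, ((∫ ω, ξ ω * Y ω ∂P : ℝ) : EReal)

/-- `Δ(c) = Δ({ξ ≤ c})` for the spectral risk measure `ρ_μ`. -/
def Delta {Ω : Type*} [MeasurableSpace Ω] (P : Measure Ω) (ξ : Ω → ℝ) (μ : Measure ℝ)
    (ρ₀ c : ℝ) : EReal :=
  minCost P ξ (spectralRisk P μ) ρ₀ {ω | ξ ω ≤ c}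

/-- `α(c) = P(ξ > c)`. -/
def tailProb {Ω : Type*} [MeasurableSpace Ω] (P : Measure Ω) (ξ : Ω → ℝ) (c : ℝ) : ℝ :=
  P.real {ω | c < ξ ω}

/-- `R(z) = E[ξ 1_{1 - F_ξ(ξ) < z}] / ∫₀^z φ(u) du`, for `z > 0`. -/
def ratio {Ω : Type*} [MeasurableSpace Ω] (P : Measure Ω) (ξ : Ω → ℝ) (μ : Measure ℝ)
    (z : ℝ) : ℝ≥0∞ :=
  (∫⁻ ω in {ω | 1 - distFun P ξ (ξ ω) < z}, ENNReal.ofReal (ξ ω) ∂P) /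
    ∫⁻ u in Ioc 0 z, spectrumFun μ u

/-- `R` on `z ≥ 0`, where the indeterminate value `0/0` at `z = 0` is replaced by
`limsup R(z)` as `z → 0⁺` (the limit whenever it exists; possibly `+∞`). -/
def ratioExt {Ω : Type*} [MeasurableSpace Ω] (P : Measure Ω) (ξ : Ω → ℝ) (μ : Measure ℝ)
    (z : ℝ) : ℝ≥0∞ :=
  if z = 0 then limsup (ratio P ξ μ) (𝓝[>] 0) else ratio P ξ μ z

/-- The essential supremum of `ξ`, as an extended real. -/
def essSupE {Ω : Type*} [MeasurableSpace Ω] (P : Measure Ω) (ξ : Ω → ℝ) : EReal :=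
  essSup (fun ω => (ξ ω : EReal)) P

end SpectralPortfolio

end

open MeasureTheory Filter Topology Set
open scoped ENNReal

namespace SpectralPortfolio

set_option linter.unusedSectionVars false

/-! ### Upper tails and quantiles of an atomless density -/

section Distribution

variable {Ω : Type*} [MeasurableSpace Ω] {P : Measure Ω} [IsProbabilityMeasure P] {ξ : Ω → ℝ}

/-! Write `G z` for the numerator of `R(z)`, `Φ z` for its denominator `∫₀^z φ`, and `α = α(c)`. The
core is `Delta_eq_neg_iSup`: `Δ(c) = -ρ₀ · sup R` over `(0, α]`, obtained by slicing positions into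
levels.

For a feasible `Y` put `p t = P(-Y > t)`. Since `Y` vanishes on `{ξ ≤ c}`, every level `t > 0` has
`p t ≤ α`. The layer-cake formula gives `E[-ξY] = ∫ E[ξ 1_{-Y > t}] dt ≤ ∫ G (p t) dt`, because the
upper tail of `ξ` is the costliest event of given probability (`setLIntegral_le_upperTail`). Fubini,
applied twice, bounds the risk below by `∫ Φ (p t) dt` (`lintegral_average_eq_spectrum`,
`lintegral_spectrumMass_le_spectralRisk`). If `R ≤ S` on `(0, α]`, then `G ≤ S Φ` level by level, so
`E[-ξY] ≤ S ρ₀` (`neg_le_Delta`). Conversely, losing the constant `ρ₀ / Φ z` on the upper tail of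
probability `z` is feasible and costs exactly `-ρ₀ R(z)` (`Delta_le_neg_ratio`).

For (i), `R` is continuous on `(0, 1]`, and assigning its limsup at `0` makes it upper
semicontinuous on the compact `[0, α]` without raising the supremum. For (ii), `G z = ∫₀^z
F_ξ⁻¹(1-u) du`, so a l'Hôpital argument gives `R → L` at `0⁺`, while `α(c) → 0⁺` as `c` increases to
the essential supremum. -/

lemma distFun_mono (X : Ω → ℝ) : Monotone (distFun P X) := fun _ _ h =>
  measureReal_mono fun _ hω => le_trans hω h

lemma tailProb_anti (X : Ω → ℝ) : Antitone (tailProb P X) := fun _ _ h =>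
  measureReal_mono fun _ hω => lt_of_le_of_lt h hω

lemma tailProb_eq_one_sub (hξ : Measurable ξ) (c : ℝ) :
    tailProb P ξ c = 1 - distFun P ξ c := by
  have h := probReal_compl_eq_one_sub (μ := P) (measurableSet_le hξ (measurable_const (a := c)))
  rw [tailProb, distFun, ← h]
  congr 1
  ext ω
  simp

lemma distFun_eq_cdf (hξ : Measurable ξ) : distFun P ξ = ProbabilityTheory.cdf (P.map ξ) := by
  have := Measure.isProbabilityMeasure_map (μ := P) hξ.aemeasurable
  ext x
  rw [ProbabilityTheory.cdf_eq_real, map_measureReal_apply hξ measurableSet_Iic]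
  rfl

lemma continuous_distFun (hξ : Measurable ξ) (hna : ∀ x : ℝ, P {ω | ξ ω = x} = 0) :
    Continuous (distFun P ξ) := by
  have := Measure.isProbabilityMeasure_map (μ := P) hξ.aemeasurable
  rw [distFun_eq_cdf hξ, continuous_iff_continuousAt]
  intro x
  have hmono := (ProbabilityTheory.cdf (P.map ξ)).mono
  rw [hmono.continuousAt_iff_leftLim_eq_rightLim, StieltjesFunction.rightLim_eq]
  have h0 : (ProbabilityTheory.cdf (P.map ξ)).measure {x} = 0 := by
    rw [ProbabilityTheory.measure_cdf, Measure.map_apply hξ (measurableSet_singleton x)]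
    exact hna x
  rw [StieltjesFunction.measure_singleton, ENNReal.ofReal_eq_zero] at h0
  exact le_antisymm (hmono.leftLim_le le_rfl) (by linarith)

lemma exists_distFun_eq (hξ : Measurable ξ) (hna : ∀ x : ℝ, P {ω | ξ ω = x} = 0)
    {p : ℝ} (h0 : 0 < p) (h1 : p < 1) : ∃ q, distFun P ξ q = p := by
  have := Measure.isProbabilityMeasure_map (μ := P) hξ.aemeasurable
  refine mem_range_of_exists_le_of_exists_ge (continuous_distFun hξ hna) ?_ ?_
  · rw [distFun_eq_cdf hξ]
    exact ((ProbabilityTheory.tendsto_cdf_atBot (P.map ξ)).eventually_le_const h0).exists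
  · rw [distFun_eq_cdf hξ]
    exact ((ProbabilityTheory.tendsto_cdf_atTop (P.map ξ)).eventually_const_le h1).exists

/-- The event that `ξ` lies in its upper tail of probability `z`. -/
def upperTail (P : Measure Ω) (ξ : Ω → ℝ) (z : ℝ) : Set Ω := {ω | 1 - distFun P ξ (ξ ω) < z}

lemma measurableSet_upperTail (hξ : Measurable ξ) (z : ℝ) :
    MeasurableSet (upperTail P ξ z) :=
  measurableSet_lt (measurable_const.sub ((distFun_mono ξ).measurable.comp hξ)) measurable_const

lemma upperTail_subset (hξ : Measurable ξ) {z c : ℝ} (hz : z ≤ tailProb P ξ c) :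
    upperTail P ξ z ⊆ {ω | c < ξ ω} := by
  intro ω hω
  rw [tailProb_eq_one_sub hξ] at hz
  by_contra hc
  have h1 := distFun_mono (P := P) ξ (not_lt.1 hc)
  have h2 : 1 - distFun P ξ (ξ ω) < z := hω
  linarith

lemma subset_upperTail (hξ : Measurable ξ) {z c : ℝ} (hz : tailProb P ξ c < z) :
    {ω | c < ξ ω} ⊆ upperTail P ξ z := by
  intro ω hω
  rw [tailProb_eq_one_sub hξ] at hz
  have h1 := distFun_mono (P := P) ξ (le_of_lt (show c < ξ ω from hω))
  change 1 - distFun P ξ (ξ ω) < z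
  linarith

lemma measureReal_upperTail (hξ : Measurable ξ) (hna : ∀ x : ℝ, P {ω | ξ ω = x} = 0)
    {z : ℝ} (h0 : 0 < z) (h1 : z ≤ 1) : P.real (upperTail P ξ z) = z := by
  apply le_antisymm
  · rcases h1.eq_or_lt with rfl | h1
    · exact measureReal_le_one
    obtain ⟨q, hq⟩ := exists_distFun_eq hξ hna (p := 1 - z) (by linarith) (by linarith)
    have ht : tailProb P ξ q = z := by rw [tailProb_eq_one_sub hξ, hq]; ring
    exact (measureReal_mono (upperTail_subset hξ ht.ge)).trans_eq ht
  -- The upper tail is approximated from inside: for `z = 1` no level `q` with tail probability `z`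
  -- need exist, and `subset_upperTail` needs a strict inequality.
  · refine le_of_forall_lt fun y hy => ?_
    obtain ⟨p, hp1, hp2⟩ := exists_between (max_lt hy h0)
    rw [max_lt_iff] at hp1
    obtain ⟨q, hq⟩ := exists_distFun_eq hξ hna (p := 1 - p) (by linarith) (by linarith)
    have ht : tailProb P ξ q = p := by rw [tailProb_eq_one_sub hξ, hq]; ring
    calc y < p := hp1.1
      _ = tailProb P ξ q := ht.symm
      _ ≤ _ := measureReal_mono (subset_upperTail hξ (ht.trans_lt hp2))

lemma measure_upperTail (hξ : Measurable ξ) (hna : ∀ x : ℝ, P {ω | ξ ω = x} = 0)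
    {z : ℝ} (h0 : 0 < z) (h1 : z ≤ 1) : P (upperTail P ξ z) = ENNReal.ofReal z := by
  rw [← ofReal_measureReal, measureReal_upperTail hξ hna h0 h1]

/-- Upper tails and superlevel sets of `ξ` are nested, so the intersection is the smaller of the
two. -/
lemma measure_upperTail_inter (hξ : Measurable ξ) (hna : ∀ x : ℝ, P {ω | ξ ω = x} = 0)
    {z : ℝ} (h0 : 0 < z) (h1 : z ≤ 1) (t : ℝ) :
    P (upperTail P ξ z ∩ {ω | t < ξ ω}) = min (ENNReal.ofReal z) (P {ω | t < ξ ω}) := by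
  rw [← measure_upperTail hξ hna h0 h1]
  rcases le_or_gt z (tailProb P ξ t) with h | h
  · have := upperTail_subset hξ h
    rw [inter_eq_left.2 this, min_eq_left (measure_mono this)]
  · have := subset_upperTail hξ h
    rw [inter_eq_right.2 this, min_eq_right (measure_mono this)]

lemma setLIntegral_eq_lintegral_meas_inter_lt (hξ : Measurable ξ) (hnn : ∀ᵐ ω ∂P, 0 ≤ ξ ω)
    (B : Set Ω) :
    ∫⁻ ω in B, ENNReal.ofReal (ξ ω) ∂P = ∫⁻ t in Ioi 0, P (B ∩ {ω | t < ξ ω}) := by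
  rw [lintegral_eq_lintegral_meas_lt (P.restrict B) (ae_restrict_of_ae hnn) hξ.aemeasurable]
  refine lintegral_congr fun t => ?_
  rw [Measure.restrict_apply (measurableSet_lt measurable_const hξ), inter_comm]

lemma setLIntegral_upperTail (hξ : Measurable ξ) (hnn : ∀ᵐ ω ∂P, 0 ≤ ξ ω)
    (hna : ∀ x : ℝ, P {ω | ξ ω = x} = 0) {z : ℝ} (h0 : 0 < z) (h1 : z ≤ 1) :
    ∫⁻ ω in upperTail P ξ z, ENNReal.ofReal (ξ ω) ∂P =
      ∫⁻ t in Ioi 0, min (ENNReal.ofReal z) (P {ω | t < ξ ω}) := by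
  rw [setLIntegral_eq_lintegral_meas_inter_lt hξ hnn]
  exact lintegral_congr fun t => measure_upperTail_inter hξ hna h0 h1 t

/-- Among the events of probability at most `z`, the upper tail maximizes `E[ξ 1_B]`. -/
lemma setLIntegral_le_upperTail (hξ : Measurable ξ) (hnn : ∀ᵐ ω ∂P, 0 ≤ ξ ω)
    (hna : ∀ x : ℝ, P {ω | ξ ω = x} = 0) {z : ℝ} (h0 : 0 < z) (h1 : z ≤ 1) {B : Set Ω}
    (hB : P B ≤ ENNReal.ofReal z) :
    ∫⁻ ω in B, ENNReal.ofReal (ξ ω) ∂P ≤ ∫⁻ ω in upperTail P ξ z, ENNReal.ofReal (ξ ω) ∂P := by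
  rw [setLIntegral_upperTail hξ hnn hna h0 h1, setLIntegral_eq_lintegral_meas_inter_lt hξ hnn]
  exact lintegral_mono fun t =>
    le_min ((measure_mono inter_subset_left).trans hB) (measure_mono inter_subset_right)

lemma volume_pos_lt_ereal (e : EReal) :
    volume {t : ℝ | 0 < t ∧ (t : EReal) < e} = e.toENNReal := by
  induction e with
  | bot => simp
  | top =>
    have : {t : ℝ | 0 < t ∧ (t : EReal) < ⊤} = Ioi 0 := by ext; simp [EReal.coe_lt_top]
    rw [this, Real.volume_Ioi, EReal.toENNReal_top]
  | coe r =>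
    have : {t : ℝ | 0 < t ∧ (t : EReal) < r} = Ioo 0 r := by ext; simp
    rw [this, Real.volume_Ioo, sub_zero, EReal.toENNReal_of_ne_top (EReal.coe_ne_top r),
      EReal.toReal_coe]

lemma volume_pos_le_ereal (e : EReal) :
    volume {t : ℝ | 0 < t ∧ (t : EReal) ≤ e} = e.toENNReal := by
  induction e with
  | bot => simp
  | top =>
    have : {t : ℝ | 0 < t ∧ (t : EReal) ≤ ⊤} = Ioi 0 := by ext; simp
    rw [this, Real.volume_Ioi, EReal.toENNReal_top]
  | coe r =>
    have : {t : ℝ | 0 < t ∧ (t : EReal) ≤ r} = Ioc 0 r := by ext; simp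
    rw [this, Real.volume_Ioc, sub_zero, EReal.toENNReal_of_ne_top (EReal.coe_ne_top r),
      EReal.toReal_coe]

lemma quantile_mono (X : Ω → ℝ) : Monotone (quantile P X) := fun _ _ h =>
  iInf₂_mono' fun x hx => ⟨x, le_trans h hx, le_rfl⟩

lemma distFun_lt_of_lt_quantile {X : Ω → ℝ} {u t : ℝ} (h : (t : EReal) < quantile P X u) :
    distFun P X t < u := by
  by_contra hc
  have : quantile P X u ≤ t := iInf₂_le t (show u ≤ distFun P X t from not_lt.1 hc)
  exact absurd h (not_lt.2 this)

lemma le_quantile_of_distFun_lt {X : Ω → ℝ} {u t : ℝ} (h : distFun P X t < u) :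
    (t : EReal) ≤ quantile P X u := by
  refine le_iInf₂ fun x hx => ?_
  rw [EReal.coe_le_coe_iff]
  by_contra hc
  have h2 : u ≤ distFun P X x := hx
  exact absurd (h.trans_le h2) (not_lt.2 (distFun_mono X (not_le.1 hc).le))

/-- The set of such `t` lies between the positive reals below the quantile and those at most the
quantile, which have equal volume. -/
lemma volume_lt_tailProb (hξ : Measurable ξ) (u : ℝ) :
    volume {t : ℝ | 0 < t ∧ u < tailProb P ξ t} = (quantile P ξ (1 - u)).toENNReal := by
  apply le_antisymm
  · rw [← volume_pos_le_ereal]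
    refine measure_mono fun t ht => ⟨ht.1, le_quantile_of_distFun_lt ?_⟩
    have := ht.2
    rw [tailProb_eq_one_sub hξ] at this
    linarith
  · rw [← volume_pos_lt_ereal]
    refine measure_mono fun t ht => ⟨ht.1, ?_⟩
    have := distFun_lt_of_lt_quantile ht.2
    rw [tailProb_eq_one_sub hξ]
    linarith

lemma measurable_upperQuantile (X : Ω → ℝ) :
    Measurable fun u => (quantile P X (1 - u)).toENNReal :=
  Antitone.measurable fun _ _ h =>
    EReal.toENNReal_le_toENNReal (quantile_mono X (by linarith))

/-- Fubini on the region `{u < P(ξ > t)}`: its slices in `u` give the layer-cake formula, its slices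
in `t` give the quantile. -/
lemma setLIntegral_upperTail_eq_quantile (hξ : Measurable ξ) (hnn : ∀ᵐ ω ∂P, 0 ≤ ξ ω)
    (hna : ∀ x : ℝ, P {ω | ξ ω = x} = 0) {z : ℝ} (h0 : 0 < z) (h1 : z ≤ 1) :
    ∫⁻ ω in upperTail P ξ z, ENNReal.ofReal (ξ ω) ∂P =
      ∫⁻ u in Ioc 0 z, (quantile P ξ (1 - u)).toENNReal := by
  have hS : MeasurableSet {p : ℝ × ℝ | p.2 < tailProb P ξ p.1} :=
    measurableSet_lt measurable_snd ((tailProb_anti ξ).measurable.comp measurable_fst)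
  rw [setLIntegral_upperTail hξ hnn hna h0 h1]
  calc ∫⁻ t in Ioi 0, min (ENNReal.ofReal z) (P {ω | t < ξ ω})
      = ∫⁻ t in Ioi 0, ∫⁻ u in Ioc 0 z,
          {p : ℝ × ℝ | p.2 < tailProb P ξ p.1}.indicator 1 (t, u) := by
        refine lintegral_congr fun t => ?_
        have : (fun u => {p : ℝ × ℝ | p.2 < tailProb P ξ p.1}.indicator (1 : ℝ × ℝ → ℝ≥0∞) (t, u))
            = (Iio (tailProb P ξ t)).indicator 1 := by
          ext u; simp [indicator_apply]
        rw [this, lintegral_indicator_one measurableSet_Iio,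
          Measure.restrict_apply measurableSet_Iio, ← ofReal_measureReal (s := {ω | t < ξ ω}),
          ← ENNReal.ofReal_min]
        change ENNReal.ofReal (min z (tailProb P ξ t)) = _
        rcases le_or_gt (tailProb P ξ t) z with h | h
        · have : Iio (tailProb P ξ t) ∩ Ioc 0 z = Ioo 0 (tailProb P ξ t) := by
            ext u; simp only [mem_inter_iff, mem_Iio, mem_Ioc, mem_Ioo]
            constructor <;> intro hu <;> refine ⟨?_, ?_⟩ <;> grind
          rw [this, Real.volume_Ioo, min_eq_right h, sub_zero]
        · have : Iio (tailProb P ξ t) ∩ Ioc 0 z = Ioc 0 z :=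
            inter_eq_right.2 fun u hu => hu.2.trans_lt h
          rw [this, Real.volume_Ioc, min_eq_left h.le, sub_zero]
    _ = ∫⁻ u in Ioc 0 z, ∫⁻ t in Ioi 0,
          {p : ℝ × ℝ | p.2 < tailProb P ξ p.1}.indicator 1 (t, u) :=
        lintegral_lintegral_swap (measurable_one.indicator hS).aemeasurable
    _ = _ := by
        refine lintegral_congr fun u => ?_
        have : (fun t => {p : ℝ × ℝ | p.2 < tailProb P ξ p.1}.indicator (1 : ℝ × ℝ → ℝ≥0∞) (t, u))
            = {t | u < tailProb P ξ t}.indicator 1 := by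
          ext u; simp [indicator_apply]
        have hm : MeasurableSet {t | u < tailProb P ξ t} :=
          measurableSet_lt measurable_const (tailProb_anti ξ).measurable
        rw [this, lintegral_indicator_one hm, Measure.restrict_apply hm, ← volume_lt_tailProb hξ]
        congr 1
        ext t
        simp [and_comm]

lemma tailProb_pos_of_lt_essSupE {c : ℝ} (hc : (c : EReal) < essSupE P ξ) :
    0 < tailProb P ξ c := by
  by_contra h
  have h0 : P {ω | c < ξ ω} = 0 :=
    (measureReal_eq_zero_iff).1 (le_antisymm (not_lt.1 h) measureReal_nonneg)
  refine absurd hc (not_lt.2 (essSup_le_of_ae_le _ ?_))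
  filter_upwards [measure_eq_zero_iff_ae_notMem.1 h0] with ω hω
  exact EReal.coe_le_coe_iff.2 (not_lt.1 hω)

lemma lt_essSupE_of_tailProb_pos {c : ℝ} (hc : 0 < tailProb P ξ c) :
    (c : EReal) < essSupE P ξ := by
  by_contra h
  refine hc.ne' ((measureReal_eq_zero_iff).2 (measure_eq_zero_iff_ae_notMem.2 ?_))
  filter_upwards [ae_le_essSup (μ := P) (f := fun ω => (ξ ω : EReal))] with ω hω
  exact not_lt.2 (EReal.coe_le_coe_iff.1 (hω.trans (not_lt.1 h)))

/-- The left limit is taken in `EReal` and pulled back to real `c`, since the essential supremum may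
be `+∞`. -/
lemma tendsto_tailProb (hξ : Measurable ξ) (hna : ∀ x : ℝ, P {ω | ξ ω = x} = 0) :
    Tendsto (tailProb P ξ) (comap (fun c : ℝ => (c : EReal)) (𝓝[<] essSupE P ξ)) (𝓝[>] 0) := by
  refine tendsto_nhdsWithin_iff.2 ⟨?_, ?_⟩
  · refine tendsto_order.2 ⟨fun a ha => Eventually.of_forall fun c =>
      ha.trans_le measureReal_nonneg, fun ε hε => ?_⟩
    obtain ⟨p, hp0, hp⟩ := exists_between (lt_min hε one_pos)
    rw [lt_min_iff] at hp
    obtain ⟨q, hq⟩ := exists_distFun_eq hξ hna (p := 1 - p) (by linarith) (by linarith)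
    have ht : tailProb P ξ q = p := by rw [tailProb_eq_one_sub hξ, hq]; ring
    have hlt : (q : EReal) < essSupE P ξ := lt_essSupE_of_tailProb_pos (ht ▸ hp0)
    have : ∀ᶠ x in 𝓝[<] essSupE P ξ, (q : EReal) < x :=
      mem_nhdsWithin_of_mem_nhds (lt_mem_nhds hlt)
    filter_upwards [this.comap _] with c hc
    exact ((tailProb_anti ξ (EReal.coe_le_coe_iff.1 hc.le)).trans_eq ht).trans_lt hp.1
  · have : ∀ᶠ x in 𝓝[<] essSupE P ξ, x < essSupE P ξ := self_mem_nhdsWithin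
    filter_upwards [this.comap _] with c hc
    exact tailProb_pos_of_lt_essSupE hc

end Distribution

/-! ### The spectrum and its mass near zero -/

section Spectrum

variable {μ : Measure ℝ}

lemma spectrumFun_anti (μ : Measure ℝ) : Antitone (spectrumFun μ) := fun _ _ h =>
  lintegral_mono_set (Ioc_subset_Ioc_left h)

/-- On `(x, 1]` the weight `1 / s` is at most `1 / x`; at `x = 0` the spectrum may be infinite. -/
lemma spectrumFun_ne_top [IsFiniteMeasure μ] {x : ℝ} (hx : 0 < x) : spectrumFun μ x ≠ ⊤ := by
  refine ne_top_of_le_ne_top ?_ (setLIntegral_mono' (g := fun _ => ENNReal.ofReal (1 / x))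
    measurableSet_Ioc fun s hs => ENNReal.ofReal_le_ofReal (one_div_le_one_div_of_le hx hs.1.le))
  rw [setLIntegral_const]
  exact ENNReal.mul_ne_top ENNReal.ofReal_ne_top (measure_ne_top _ _)

/-- Averaging over `(0, β]` and then over `β` amounts to weighting by the spectrum. -/
lemma lintegral_average_eq_spectrum [SFinite μ] {w : ℝ → ℝ≥0∞} (hw : Measurable w) :
    ∫⁻ β in Ioc 0 1, (ENNReal.ofReal (1 / β) * ∫⁻ u in Ioc 0 β, w u) ∂μ =
      ∫⁻ u in Ioc 0 1, w u * spectrumFun μ u := by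
  have hS : MeasurableSet {p : ℝ × ℝ | p.2 < p.1} := measurableSet_lt measurable_snd measurable_fst
  let g : ℝ × ℝ → ℝ≥0∞ := {p : ℝ × ℝ | p.2 < p.1}.indicator
    fun p => w p.2 * ENNReal.ofReal (1 / p.1)
  have hg : Measurable g := Measurable.indicator (by fun_prop) hS
  calc ∫⁻ β in Ioc 0 1, (ENNReal.ofReal (1 / β) * ∫⁻ u in Ioc 0 β, w u) ∂μ
      = ∫⁻ β in Ioc 0 1, (∫⁻ u in Ioc 0 1, g (β, u)) ∂μ := by
        refine setLIntegral_congr_fun measurableSet_Ioc fun β hβ => ?_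
        have h1 : ∀ u, g (β, u) =
            (Iio β).indicator (fun u => w u * ENNReal.ofReal (1 / β)) u := by
          intro u; simp [g, indicator_apply]
        have h2 : Iio β ∩ Ioc 0 1 = Ioo 0 β := by
          ext u
          simp only [mem_inter_iff, mem_Iio, mem_Ioc, mem_Ioo] at hβ ⊢
          grind
        simp only [h1]
        rw [lintegral_indicator measurableSet_Iio, Measure.restrict_restrict measurableSet_Iio, h2,
          restrict_Ioo_eq_restrict_Ioc, lintegral_mul_const _ hw, mul_comm]
    _ = ∫⁻ u in Ioc 0 1, ∫⁻ β in Ioc 0 1, g (β, u) ∂μ :=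
        lintegral_lintegral_swap (f := fun β u => g (β, u)) hg.aemeasurable
    _ = _ := by
        refine setLIntegral_congr_fun measurableSet_Ioc fun u hu => ?_
        have h1 : ∀ β, g (β, u) =
            (Ioi u).indicator (fun β => w u * ENNReal.ofReal (1 / β)) β := by
          intro β; simp [g, indicator_apply]
        have h2 : Ioi u ∩ Ioc 0 1 = Ioc u 1 := by
          ext β
          simp only [mem_inter_iff, mem_Ioi, mem_Ioc] at hu ⊢
          grind
        simp only [h1]
        rw [lintegral_indicator measurableSet_Ioi, Measure.restrict_restrict measurableSet_Ioi, h2,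
          lintegral_const_mul _ (by fun_prop)]
        rfl

/-- The integral of the spectrum over `(0, z]`. -/
noncomputable def spectrumMass (μ : Measure ℝ) (z : ℝ) : ℝ≥0∞ := ∫⁻ u in Ioc 0 z, spectrumFun μ u

lemma spectrumMass_mono (μ : Measure ℝ) : Monotone (spectrumMass μ) := fun _ _ h =>
  lintegral_mono_set (Ioc_subset_Ioc_right h)

variable [IsProbabilityMeasure μ]

lemma spectrumMass_one (hμ : μ (Ioc 0 1)ᶜ = 0) : spectrumMass μ 1 = 1 := by
  have h := lintegral_average_eq_spectrum (μ := μ) (w := fun _ => 1) measurable_const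
  simp only [one_mul] at h
  rw [spectrumMass, ← h, setLIntegral_congr_fun (g := fun _ => 1) measurableSet_Ioc]
  · rw [setLIntegral_one]
    exact (prob_compl_eq_zero_iff measurableSet_Ioc).1 hμ
  · intro β hβ
    change ENNReal.ofReal (1 / β) * ∫⁻ u in Ioc 0 β, 1 = 1
    rw [setLIntegral_one, Real.volume_Ioc, sub_zero, ← ENNReal.ofReal_mul (by
      have := hβ.1; positivity), one_div, inv_mul_cancel₀ hβ.1.ne', ENNReal.ofReal_one]

lemma spectrumMass_ne_top (hμ : μ (Ioc 0 1)ᶜ = 0) {z : ℝ} (hz : z ≤ 1) :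
    spectrumMass μ z ≠ ⊤ :=
  ne_top_of_le_ne_top (by simp [spectrumMass_one hμ]) (spectrumMass_mono μ hz)

lemma exists_spectrumFun_ne_zero (hμ : μ (Ioc 0 1)ᶜ = 0) : ∃ s > 0, spectrumFun μ s ≠ 0 := by
  by_contra! h
  have h1 := spectrumMass_one hμ
  rw [spectrumMass, setLIntegral_congr_fun (g := fun _ => 0) measurableSet_Ioc
    fun u hu => h u hu.1] at h1
  simp at h1

lemma eventually_spectrumFun_ne_zero (hμ : μ (Ioc 0 1)ᶜ = 0) :
    ∀ᶠ x in 𝓝[>] 0, spectrumFun μ x ≠ 0 := by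
  obtain ⟨s, hs, h⟩ := exists_spectrumFun_ne_zero hμ
  filter_upwards [Ioo_mem_nhdsGT hs] with x hx
  exact ((pos_iff_ne_zero.2 h).trans_le (spectrumFun_anti μ hx.2.le)).ne'

/-- The spectrum is nonincreasing and nonzero at some `s > 0`, so a rectangle of positive area fits
under its graph on `(0, min s z]`. -/
lemma spectrumMass_ne_zero (hμ : μ (Ioc 0 1)ᶜ = 0) {z : ℝ} (hz : 0 < z) :
    spectrumMass μ z ≠ 0 := by
  obtain ⟨s, hs, h⟩ := exists_spectrumFun_ne_zero hμ
  have hm : 0 < min s z := lt_min hs hz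
  have h1 : spectrumFun μ s * ENNReal.ofReal (min s z) ≤ spectrumMass μ z := by
    calc spectrumFun μ s * ENNReal.ofReal (min s z)
        = ∫⁻ _ in Ioc 0 (min s z), spectrumFun μ s := by
          rw [setLIntegral_const, Real.volume_Ioc, sub_zero]
      _ ≤ ∫⁻ u in Ioc 0 (min s z), spectrumFun μ u :=
          setLIntegral_mono' measurableSet_Ioc fun u hu =>
            spectrumFun_anti μ (hu.2.trans (min_le_left _ _))
      _ ≤ _ := spectrumMass_mono μ (min_le_right _ _)
  refine (lt_of_lt_of_le ?_ h1).ne'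
  exact ENNReal.mul_pos h (by simpa using hm)

end Spectrum

/-! ### Spectral risk of nonpositive positions as a weighted integral of VaR -/

section Risk

variable {Ω : Type*} [MeasurableSpace Ω] {P : Measure Ω} [IsProbabilityMeasure P]

lemma extIntegral_of_nonneg {α : Type*} [MeasurableSpace α] {ν : Measure α} {f : α → EReal}
    (hf : ∀ᵐ a ∂ν, 0 ≤ f a) :
    extIntegral ν f = ((∫⁻ a, (f a).toENNReal ∂ν : ℝ≥0∞) : EReal) := by
  have h0 : ∫⁻ a, (-f a).toENNReal ∂ν = 0 := by
    rw [lintegral_congr_ae (g := fun _ => 0), lintegral_zero]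
    filter_upwards [hf] with a ha
    exact EReal.toENNReal_of_nonpos (by simpa using ha)
  rw [extIntegral, h0]
  split_ifs with h <;> simp [h]

lemma VaR_nonneg {Y : Ω → ℝ} (hY : ∀ᵐ ω ∂P, Y ω ≤ 0) {u : ℝ} (hu : u ≤ 1) : 0 ≤ VaR P Y u := by
  have h1 : distFun P Y 0 = 1 := by
    rw [distFun, measureReal_congr (eventuallyEq_univ.2 hY), probReal_univ]
  have : quantile P Y u ≤ (0 : ℝ) := iInf₂_le (0 : ℝ) (show u ≤ distFun P Y 0 by rwa [h1])
  rw [VaR]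
  exact EReal.neg_nonneg.2 this

lemma measurable_VaR (Y : Ω → ℝ) : Measurable fun u => (VaR P Y u).toENNReal :=
  Antitone.measurable fun _ _ h =>
    EReal.toENNReal_le_toENNReal (EReal.neg_le_neg_iff.2 (quantile_mono Y h))

lemma CVaR_eq_lintegral {Y : Ω → ℝ} (hY : ∀ᵐ ω ∂P, Y ω ≤ 0) {β : ℝ} (h0 : 0 < β) (h1 : β ≤ 1) :
    CVaR P β Y =
      ((ENNReal.ofReal (1 / β) * ∫⁻ u in Ioc 0 β, (VaR P Y u).toENNReal : ℝ≥0∞) : EReal) := by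
  rw [CVaR, extIntegral_of_nonneg ((ae_restrict_mem measurableSet_Ioc).mono fun u hu =>
    VaR_nonneg hY (le_trans hu.2 h1)), EReal.coe_ennreal_mul, EReal.coe_ennreal_ofReal,
    max_eq_left (by positivity)]

/-- For `Y ≤ 0` every VaR and CVaR involved is nonnegative, so the extended integrals have no
negative part and Tonelli applies. -/
lemma spectralRisk_eq_lintegral {μ : Measure ℝ} [SFinite μ] {Y : Ω → ℝ}
    (hY : ∀ᵐ ω ∂P, Y ω ≤ 0) :
    spectralRisk P μ Y =
      ((∫⁻ u in Ioc 0 1, (VaR P Y u).toENNReal * spectrumFun μ u : ℝ≥0∞) : EReal) := by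
  rw [spectralRisk, extIntegral_of_nonneg, ← lintegral_average_eq_spectrum (measurable_VaR Y)]
  · congr 1
    refine setLIntegral_congr_fun measurableSet_Ioc fun β hβ => ?_
    simp only [CVaR_eq_lintegral hY hβ.1 hβ.2, EReal.toENNReal_coe]
  · filter_upwards [ae_restrict_mem measurableSet_Ioc] with β hβ
    rw [CVaR_eq_lintegral hY hβ.1 hβ.2]
    exact EReal.coe_ennreal_nonneg _

end Risk

/-! ### The two bounds on the minimal cost -/

section Bounds

variable {Ω : Type*} [MeasurableSpace Ω] {P : Measure Ω} [IsProbabilityMeasure P] {ξ : Ω → ℝ}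
  {μ : Measure ℝ} [IsProbabilityMeasure μ]

lemma ratio_eq (z : ℝ) : ratio P ξ μ z =
    (∫⁻ ω in upperTail P ξ z, ENNReal.ofReal (ξ ω) ∂P) / spectrumMass μ z := rfl

lemma setLIntegral_ofReal_ne_top (hint : Integrable ξ P) (B : Set Ω) :
    ∫⁻ ω in B, ENNReal.ofReal (ξ ω) ∂P ≠ ⊤ :=
  (lt_of_le_of_lt (setLIntegral_le_lintegral _ _) hint.lintegral_lt_top).ne

/-- The position never falls below `-k`, and a level `u > z ≥ P(T)` cannot be reached by `P(Y ≤ x)`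
with `x < 0`. An upper bound is enough to check feasibility. -/
lemma VaR_indicator_le {T : Set Ω} {z k : ℝ} (hT : P.real T ≤ z) (hk : 0 ≤ k) {u : ℝ}
    (hu : 0 < u) : (VaR P (T.indicator fun _ => -k) u).toENNReal ≤
      (Ioc 0 z).indicator (fun _ => ENNReal.ofReal k) u := by
  set Y : Ω → ℝ := T.indicator fun _ => -k with hY
  by_cases huz : u ≤ z
  · rw [indicator_of_mem (show u ∈ Ioc 0 z from ⟨hu, huz⟩)]
    have h1 : ((-k : ℝ) : EReal) ≤ quantile P Y u := by
      refine le_iInf₂ fun x hx => EReal.coe_le_coe_iff.2 ?_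
      by_contra hc
      have : {ω | Y ω ≤ x} = ∅ := by
        ext ω
        have hx0 : x < -k := not_le.1 hc
        by_cases h : ω ∈ T <;> simp [hY, h] <;> linarith
      have hx' : u ≤ distFun P Y x := hx
      rw [distFun, this, measureReal_empty] at hx'
      linarith
    have h2 : VaR P Y u ≤ (k : EReal) := by
      rw [VaR, EReal.neg_le, ← EReal.coe_neg]
      exact h1
    calc (VaR P Y u).toENNReal ≤ (k : EReal).toENNReal := EReal.toENNReal_le_toENNReal h2
      _ = ENNReal.ofReal k := by
        rw [EReal.toENNReal_of_ne_top (EReal.coe_ne_top k), EReal.toReal_coe]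
  · rw [indicator_of_notMem (fun h => huz h.2)]
    have h1 : ((0 : ℝ) : EReal) ≤ quantile P Y u := by
      refine le_iInf₂ fun x hx => EReal.coe_le_coe_iff.2 ?_
      by_contra hc
      have : {ω | Y ω ≤ x} ⊆ T := by
        intro ω hω
        by_contra hn
        have h0 : Y ω ≤ x := hω
        rw [hY, indicator_of_notMem hn] at h0
        exact hc h0
      have hx' : u ≤ distFun P Y x := hx
      have h2 : distFun P Y x ≤ z := (measureReal_mono this).trans hT
      linarith
    refine (EReal.toENNReal_of_nonpos ?_).le
    rw [VaR, EReal.neg_le, neg_zero]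
    exact h1

lemma Delta_le_neg_ratio (hξ : Measurable ξ) (hnn : ∀ᵐ ω ∂P, 0 ≤ ξ ω)
    (hint : Integrable ξ P) (hna : ∀ x : ℝ, P {ω | ξ ω = x} = 0)
    (hμ : μ (Ioc 0 1)ᶜ = 0) {ρ₀ : ℝ} (hρ₀ : 0 < ρ₀) {c z : ℝ} (h0 : 0 < z)
    (hz : z ≤ tailProb P ξ c) :
    Delta P ξ μ ρ₀ c ≤ -((ρ₀ : EReal) * (ratio P ξ μ z : EReal)) := by
  have h1 : z ≤ 1 := hz.trans measureReal_le_one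
  have hΦ0 := spectrumMass_ne_zero hμ h0
  have hΦt := spectrumMass_ne_top hμ h1
  set r := (spectrumMass μ z).toReal with hr
  have hr0 : 0 < r := ENNReal.toReal_pos hΦ0 hΦt
  -- The size of the loss for which `k · Φ z`, the bound on the risk, equals `ρ₀`.
  set k := ρ₀ / r with hk
  have hk0 : 0 < k := div_pos hρ₀ hr0
  have hTm := measurableSet_upperTail (P := P) hξ z
  have hGt := setLIntegral_ofReal_ne_top (P := P) hint (upperTail P ξ z)
  set T := upperTail P ξ z with hT
  set G := ∫⁻ ω in T, ENNReal.ofReal (ξ ω) ∂P with hG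
  set Y : Ω → ℝ := T.indicator fun _ => -k with hY
  have hY0 : ∀ ω, Y ω ≤ 0 := fun ω => by
    by_cases h : ω ∈ T <;> simp [hY, h, hk0.le]
  have hmem : Y ∈ lossSet P ξ (spectralRisk P μ) ρ₀ {ω | ξ ω ≤ c} := by
    refine ⟨?_, ?_, ?_, Eventually.of_forall fun ω _ => hY0 ω⟩
    · have := isFiniteMeasure_withDensity_ofReal hint.2
      exact (integrable_const _).indicator hTm
    · rw [spectralRisk_eq_lintegral (Eventually.of_forall hY0)]
      have : ∫⁻ u in Ioc 0 1, (VaR P Y u).toENNReal * spectrumFun μ u ≤ ENNReal.ofReal ρ₀ := by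
        calc ∫⁻ u in Ioc 0 1, (VaR P Y u).toENNReal * spectrumFun μ u
            ≤ ∫⁻ u in Ioc 0 1,
                (Ioc 0 z).indicator (fun u => ENNReal.ofReal k * spectrumFun μ u) u := by
              refine setLIntegral_mono' measurableSet_Ioc fun u hu => ?_
              refine (mul_le_mul_left (VaR_indicator_le (P := P)
                (measureReal_upperTail hξ hna h0 h1).le hk0.le hu.1) _).trans_eq ?_
              simp only [indicator_apply]
              split_ifs <;> simp
          _ ≤ ∫⁻ u, (Ioc 0 z).indicator (fun u => ENNReal.ofReal k * spectrumFun μ u) u :=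
              setLIntegral_le_lintegral _ _
          _ = ENNReal.ofReal k * spectrumMass μ z := by
              rw [lintegral_indicator measurableSet_Ioc,
                lintegral_const_mul _ (spectrumFun_anti μ).measurable, spectrumMass]
          _ = ENNReal.ofReal ρ₀ := by
              rw [← ENNReal.ofReal_toReal hΦt, ← ENNReal.ofReal_mul hk0.le, hk, ← hr,
                div_mul_cancel₀ _ hr0.ne']
      refine (EReal.coe_ennreal_le_coe_ennreal_iff.2 this).trans_eq ?_
      rw [EReal.coe_ennreal_ofReal, max_eq_left hρ₀.le]
    · refine Eventually.of_forall fun ω hω => ?_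
      refine indicator_of_notMem (fun h => ?_) _
      have h2 : c < ξ ω := upperTail_subset hξ hz h
      exact absurd h2 (not_lt.2 hω)
  refine (iInf₂_le Y hmem).trans_eq ?_
  have h2 : ∫ ω, ξ ω * Y ω ∂P = -(k * G.toReal) := by
    have : (fun ω => ξ ω * Y ω) = T.indicator fun ω => -k * ξ ω := by
      ext ω
      by_cases h : ω ∈ T <;> simp [hY, h, mul_comm]
    rw [this, integral_indicator hTm, integral_const_mul, integral_eq_lintegral_of_nonneg_ae
      (ae_restrict_of_ae hnn) hξ.aestronglyMeasurable, neg_mul]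
  have h3 : ratio P ξ μ z = ENNReal.ofReal (G.toReal / r) := by
    rw [ratio_eq, ENNReal.ofReal_div_of_pos hr0, ENNReal.ofReal_toReal hGt,
      ENNReal.ofReal_toReal hΦt]
  rw [h2, h3, EReal.coe_ennreal_ofReal, max_eq_left (by positivity), ← EReal.coe_mul,
    ← EReal.coe_neg, hk]
  congr 2
  ring

/-- The spectral risk of a nonpositive position dominates its distorted layer-cake integral. -/
lemma lintegral_spectrumMass_le_spectralRisk (Y : Ω → ℝ) :
    ∫⁻ t in Ioi 0, spectrumMass μ (tailProb P (fun ω => -Y ω) t) ≤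
      ∫⁻ u in Ioc 0 1, (VaR P Y u).toENNReal * spectrumFun μ u := by
  set p := tailProb P (fun ω => -Y ω) with hp
  have hpm : Measurable p := (tailProb_anti _).measurable
  have hφm := (spectrumFun_anti μ).measurable
  have hS : MeasurableSet {q : ℝ × ℝ | q.2 < p q.1} :=
    measurableSet_lt measurable_snd (hpm.comp measurable_fst)
  let g : ℝ × ℝ → ℝ≥0∞ := {q : ℝ × ℝ | q.2 < p q.1}.indicator fun q => spectrumFun μ q.2
  have hg : Measurable g := (hφm.comp measurable_snd).indicator hS
  calc ∫⁻ t in Ioi 0, spectrumMass μ (p t)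
      = ∫⁻ t in Ioi 0, ∫⁻ u in Ioc 0 1, g (t, u) := by
        refine lintegral_congr fun t => ?_
        have h1 : ∀ u, g (t, u) = (Iio (p t)).indicator (spectrumFun μ) u := by
          intro u; simp [g, indicator_apply]
        have h2 : Iio (p t) ∩ Ioc 0 1 = Ioo 0 (p t) := by
          have hp1 : p t ≤ 1 := measureReal_le_one
          ext u
          simp only [mem_inter_iff, mem_Iio, mem_Ioc, mem_Ioo]
          grind
        simp only [h1]
        rw [lintegral_indicator measurableSet_Iio, Measure.restrict_restrict measurableSet_Iio, h2,
          restrict_Ioo_eq_restrict_Ioc]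
        rfl
    _ = ∫⁻ u in Ioc 0 1, ∫⁻ t in Ioi 0, g (t, u) :=
        lintegral_lintegral_swap (f := fun t u => g (t, u)) hg.aemeasurable
    _ ≤ _ := by
        refine lintegral_mono fun u => ?_
        have h1 : ∀ t, g (t, u) = {t | u < p t}.indicator (fun _ => spectrumFun μ u) t := by
          intro t; simp [g, indicator_apply]
        have hm : MeasurableSet {t | u < p t} := measurableSet_lt measurable_const hpm
        simp only [h1]
        rw [lintegral_indicator hm, setLIntegral_const, Measure.restrict_apply hm, mul_comm]
        gcongr
        rw [← volume_pos_le_ereal]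
        refine measure_mono fun t ht => ⟨ht.2, ?_⟩
        have h3 : u < p t := ht.1
        have h4 : u ≤ distFun P Y (-t) := h3.le.trans
          (measureReal_mono fun ω (hω : t < -Y ω) => show Y ω ≤ -t by linarith)
        have h5 : quantile P Y u ≤ ((-t : ℝ) : EReal) := iInf₂_le (-t) h4
        rw [VaR, EReal.le_neg, ← EReal.coe_neg]
        exact h5

lemma neg_le_Delta (hξ : Measurable ξ) (hnn : ∀ᵐ ω ∂P, 0 ≤ ξ ω)
    (hna : ∀ x : ℝ, P {ω | ξ ω = x} = 0)
    (hμ : μ (Ioc 0 1)ᶜ = 0) {ρ₀ : ℝ} (hρ₀ : 0 < ρ₀) {c : ℝ} {S : ℝ≥0∞}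
    (hS : ∀ z ∈ Ioc 0 (tailProb P ξ c), ratio P ξ μ z ≤ S) :
    -((ρ₀ : EReal) * (S : EReal)) ≤ Delta P ξ μ ρ₀ c := by
  refine le_iInf₂ fun Y hY => ?_
  obtain ⟨hYint, hYrisk, hYzero, hYneg⟩ := hY
  set ν := P.withDensity fun ω => ENNReal.ofReal (ξ ω) with hν
  have hνP : ν ≪ P := withDensity_absolutelyContinuous _ _
  -- No atom at `0` forces `ξ > 0` almost surely, so `P` and `ν` have the same null sets and
  -- measurability of `Y` transfers from `ν` to `P`.
  have hPν : P ≪ ν := by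
    refine withDensity_absolutelyContinuous' hξ.ennreal_ofReal.aemeasurable ?_
    filter_upwards [hnn, measure_eq_zero_iff_ae_notMem.1 (hna 0)] with ω h1 h2
    rw [ENNReal.ofReal_ne_zero_iff]
    exact lt_of_le_of_ne h1 (Ne.symm h2)
  have hYm : AEStronglyMeasurable Y P := hYint.aestronglyMeasurable.mono_ac hPν
  have hY0 : ∀ᵐ ω ∂P, Y ω ≤ 0 := by
    filter_upwards [hYzero, hYneg] with ω h1 h2
    by_cases h : ω ∈ {ω | ξ ω ≤ c}
    · exact (h1 h).le
    · exact h2 h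
  set p := tailProb P (fun ω => -Y ω) with hp
  have hpc : ∀ t > 0, p t ≤ tailProb P ξ c := by
    intro t ht
    refine ENNReal.toReal_mono (measure_ne_top _ _) (measure_mono_ae ?_)
    filter_upwards [hYzero] with ω h1 (h2 : t < -Y ω)
    by_contra h
    have := h1 (not_lt.1 h)
    linarith
  have hlayer : ∀ t > 0, ν {ω | t < -Y ω} ≤ S * spectrumMass μ (p t) := by
    intro t ht
    -- The bound on `R` is available only for `z > 0`; a level with `p t = 0` is null for `ν` as
    -- well.
    rcases (measureReal_nonneg : 0 ≤ p t).eq_or_lt with h | h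
    · rw [hνP ((measureReal_eq_zero_iff).1 h.symm)]
      exact zero_le
    · change 0 < p t at h
      have hp1 : p t ≤ 1 := measureReal_le_one
      rw [hν, withDensity_apply' _ _, ← ENNReal.div_le_iff
        (spectrumMass_ne_zero hμ h) (spectrumMass_ne_top hμ hp1)]
      refine le_trans ?_ (hS (p t) ⟨h, hpc t ht⟩)
      rw [ratio_eq]
      refine ENNReal.div_le_div_right (setLIntegral_le_upperTail hξ hnn hna h hp1 ?_) _
      rw [hp, tailProb, ofReal_measureReal]
  have hcost : ∫⁻ ω, ENNReal.ofReal (-(ξ ω * Y ω)) ∂P ≤ S * ENNReal.ofReal ρ₀ := by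
    calc ∫⁻ ω, ENNReal.ofReal (-(ξ ω * Y ω)) ∂P
        = ∫⁻ ω, ENNReal.ofReal (-Y ω) ∂ν := by
          rw [hν, lintegral_withDensity_eq_lintegral_mul₀ hξ.ennreal_ofReal.aemeasurable
            (show AEMeasurable (fun ω => ENNReal.ofReal (-Y ω)) P from
              hYm.aemeasurable.neg.ennreal_ofReal)]
          refine lintegral_congr_ae ?_
          filter_upwards [hnn] with ω h
          rw [Pi.mul_apply, ← ENNReal.ofReal_mul h]
          congr 1
          simp
      _ = ∫⁻ t in Ioi 0, ν {ω | t < -Y ω} :=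
          lintegral_eq_lintegral_meas_lt ν
            (hνP.ae_le (hY0.mono fun ω h => by simpa using h)) hYint.aemeasurable.neg
      _ ≤ ∫⁻ t in Ioi 0, S * spectrumMass μ (p t) :=
          setLIntegral_mono' measurableSet_Ioi fun t ht => hlayer t ht
      _ = S * ∫⁻ t in Ioi 0, spectrumMass μ (p t) :=
          lintegral_const_mul _ ((spectrumMass_mono μ).measurable.comp (tailProb_anti _).measurable)
      _ ≤ S * ENNReal.ofReal ρ₀ := by
          gcongr
          refine (lintegral_spectrumMass_le_spectralRisk Y).trans ?_
          rw [spectralRisk_eq_lintegral hY0] at hYrisk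
          have := EReal.toENNReal_le_toENNReal hYrisk
          rwa [EReal.toENNReal_coe, EReal.toENNReal_of_ne_top (EReal.coe_ne_top _),
            EReal.toReal_coe] at this
  have hE : ∫ ω, ξ ω * Y ω ∂P = -(∫⁻ ω, ENNReal.ofReal (-(ξ ω * Y ω)) ∂P).toReal := by
    rw [← integral_eq_lintegral_of_nonneg_ae, integral_neg, neg_neg]
    · filter_upwards [hnn, hY0] with ω h1 h2
      simpa using mul_nonpos_of_nonneg_of_nonpos h1 h2
    · exact (hξ.aestronglyMeasurable.mul hYm).neg
  rw [hE, EReal.coe_neg, EReal.neg_le_neg_iff]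
  calc (((∫⁻ ω, ENNReal.ofReal (-(ξ ω * Y ω)) ∂P).toReal : ℝ) : EReal)
      ≤ ((∫⁻ ω, ENNReal.ofReal (-(ξ ω * Y ω)) ∂P : ℝ≥0∞) : EReal) := by
        rw [← EReal.toReal_coe_ennreal]
        exact EReal.coe_toReal_le (by simp)
    _ ≤ ((S * ENNReal.ofReal ρ₀ : ℝ≥0∞) : EReal) := EReal.coe_ennreal_le_coe_ennreal_iff.2 hcost
    _ = _ := by
        rw [EReal.coe_ennreal_mul, EReal.coe_ennreal_ofReal, max_eq_left hρ₀.le, mul_comm]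

end Bounds

/-! ### Integrals over shrinking intervals -/

section Limits

lemma continuousOn_setLIntegral_Ioc {f : ℝ → ℝ≥0∞} (hf : Measurable f)
    (hfin : ∫⁻ u in Ioc 0 1, f u ≠ ⊤) :
    ContinuousOn (fun z : ℝ => ∫⁻ u in Ioc 0 z, f u) (Icc 0 1) := by
  intro z₀ hz₀
  have h : ∀ z, ∫⁻ u in Ioc 0 z, f u = ∫⁻ u, (Ioc 0 z).indicator f u := fun z =>
    (lintegral_indicator measurableSet_Ioc f).symm
  simp only [ContinuousWithinAt, h]
  refine tendsto_lintegral_filter_of_dominated_convergence ((Ioc 0 1).indicator f)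
    (Eventually.of_forall fun z => hf.indicator measurableSet_Ioc) ?_ ?_ ?_
  · filter_upwards [self_mem_nhdsWithin] with z hz
    exact Eventually.of_forall fun u =>
      indicator_le_indicator_of_subset (Ioc_subset_Ioc_right hz.2) (fun _ => zero_le) u
  · rwa [lintegral_indicator measurableSet_Ioc]
  -- Off the null point `u = z₀`, the indicator of `(0, z]` at `u` is eventually constant in `z`.
  · have hne : ∀ᵐ u : ℝ, u ≠ z₀ := by
      simp [ae_iff]
    filter_upwards [hne] with u hu
    refine tendsto_const_nhds.congr' ?_
    rcases lt_or_gt_of_ne hu with h1 | h1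
    · filter_upwards [mem_nhdsWithin_of_mem_nhds (lt_mem_nhds h1)] with z hz
      simp [indicator_apply, h1.le, (show u < z from hz).le]
    · filter_upwards [mem_nhdsWithin_of_mem_nhds (gt_mem_nhds h1)] with z hz
      simp [h1, (show z < u from hz)]

/-- A quotient of integrals over `(0, z]` has the same limit at `0⁺` as the quotient of the
integrands. -/
lemma tendsto_setLIntegral_div {f g : ℝ → ℝ≥0∞} {L : ℝ≥0∞} (hg : Measurable g)
    (hg0 : ∀ᶠ x in 𝓝[>] 0, g x ≠ 0) (hgt : ∀ᶠ x in 𝓝[>] 0, g x ≠ ⊤)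
    (hG0 : ∀ᶠ z in 𝓝[>] (0 : ℝ), ∫⁻ u in Ioc 0 z, g u ≠ 0)
    (hGt : ∀ᶠ z in 𝓝[>] (0 : ℝ), ∫⁻ u in Ioc 0 z, g u ≠ ⊤)
    (h : Tendsto (fun x => f x / g x) (𝓝[>] 0) (𝓝 L)) :
    Tendsto (fun z => (∫⁻ u in Ioc 0 z, f u) / ∫⁻ u in Ioc 0 z, g u) (𝓝[>] 0) (𝓝 L) := by
  refine tendsto_order.2 ⟨fun a ha => ?_, fun b hb => ?_⟩
  · obtain ⟨a', ha1, ha2⟩ := exists_between ha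
    have hev := (((tendsto_order.1 h).1 a' ha2).and hg0).and hgt
    -- On `(0, δ]` the pointwise bound `a' g ≤ f` integrates to the same bound between the
    -- integrals; only `g` has to be measurable.
    obtain ⟨δ, hδ, hsub⟩ := mem_nhdsGT_iff_exists_Ioc_subset.1 hev
    filter_upwards [hG0, hGt, Ioc_mem_nhdsGT hδ] with z h0 ht hz
    refine ha1.trans_le ?_
    rw [ENNReal.le_div_iff_mul_le (Or.inl h0) (Or.inl ht), ← lintegral_const_mul _ hg]
    refine setLIntegral_mono' measurableSet_Ioc fun u hu => ?_
    obtain ⟨⟨h1, h2⟩, h3⟩ := hsub ⟨hu.1, hu.2.trans hz.2⟩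
    exact (ENNReal.le_div_iff_mul_le (Or.inl h2) (Or.inl h3)).1 h1.le
  · obtain ⟨b', hb1, hb2⟩ := exists_between hb
    have hev := (((tendsto_order.1 h).2 b' hb1).and hg0).and hgt
    obtain ⟨δ, hδ, hsub⟩ := mem_nhdsGT_iff_exists_Ioc_subset.1 hev
    filter_upwards [hG0, hGt, Ioc_mem_nhdsGT hδ] with z h0 ht hz
    refine lt_of_le_of_lt ?_ hb2
    rw [ENNReal.div_le_iff h0 ht, ← lintegral_const_mul _ hg]
    refine setLIntegral_mono' measurableSet_Ioc fun u hu => ?_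
    obtain ⟨⟨h1, h2⟩, h3⟩ := hsub ⟨hu.1, hu.2.trans hz.2⟩
    exact (ENNReal.div_le_iff h2 h3).1 h1.le

lemma tendsto_iSup_Ioc {f : ℝ → ℝ≥0∞} {L : ℝ≥0∞} (h : Tendsto f (𝓝[>] 0) (𝓝 L)) :
    Tendsto (fun a : ℝ => ⨆ z ∈ Ioc 0 a, f z) (𝓝[>] 0) (𝓝 L) := by
  refine tendsto_order.2 ⟨fun a ha => ?_, fun b hb => ?_⟩
  · filter_upwards [(tendsto_order.1 h).1 a ha, self_mem_nhdsWithin] with z h1 h2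
    exact h1.trans_le (le_iSup₂ (f := fun y (_ : y ∈ Ioc 0 z) => f y) z ⟨h2, le_rfl⟩)
  · obtain ⟨b', hb1, hb2⟩ := exists_between hb
    obtain ⟨δ, hδ, hsub⟩ := mem_nhdsGT_iff_exists_Ioc_subset.1 ((tendsto_order.1 h).2 b' hb1)
    filter_upwards [Ioc_mem_nhdsGT hδ] with a ha
    refine lt_of_le_of_lt (iSup₂_le fun z hz => ?_) hb2
    exact (show f z < b' from hsub ⟨hz.1, hz.2.trans ha.2⟩).le

end Limits

/-! ### Attainment of the maximum and the limit -/

section Main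

variable {Ω : Type*} [MeasurableSpace Ω] {P : Measure Ω} [IsProbabilityMeasure P] {ξ : Ω → ℝ}
  {μ : Measure ℝ} [IsProbabilityMeasure μ]

lemma ratio_eq_quantile (hξ : Measurable ξ) (hnn : ∀ᵐ ω ∂P, 0 ≤ ξ ω)
    (hna : ∀ x : ℝ, P {ω | ξ ω = x} = 0) {z : ℝ} (h0 : 0 < z) (h1 : z ≤ 1) :
    ratio P ξ μ z =
      (∫⁻ u in Ioc 0 z, (quantile P ξ (1 - u)).toENNReal) / spectrumMass μ z := by
  rw [ratio_eq, setLIntegral_upperTail_eq_quantile hξ hnn hna h0 h1]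

lemma continuousOn_ratio (hξ : Measurable ξ) (hnn : ∀ᵐ ω ∂P, 0 ≤ ξ ω) (hint : Integrable ξ P)
    (hna : ∀ x : ℝ, P {ω | ξ ω = x} = 0) (hμ : μ (Ioc 0 1)ᶜ = 0) :
    ContinuousOn (ratio P ξ μ) (Ioc 0 1) := by
  have hsub : Ioc (0 : ℝ) 1 ⊆ Icc 0 1 := Ioc_subset_Icc_self
  have hq : ∫⁻ u in Ioc 0 1, (quantile P ξ (1 - u)).toENNReal ≠ ⊤ := by
    rw [← setLIntegral_upperTail_eq_quantile hξ hnn hna one_pos le_rfl]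
    exact setLIntegral_ofReal_ne_top hint _
  have h1 := (continuousOn_setLIntegral_Ioc (measurable_upperQuantile ξ) hq).mono hsub
  have h2 := (continuousOn_setLIntegral_Ioc (spectrumFun_anti μ).measurable
    (spectrumMass_ne_top hμ le_rfl)).mono hsub
  refine ContinuousOn.congr (f := fun z =>
    (∫⁻ u in Ioc 0 z, (quantile P ξ (1 - u)).toENNReal) / spectrumMass μ z) ?_
    fun z hz => ratio_eq_quantile hξ hnn hna hz.1 hz.2
  intro z hz
  exact ENNReal.Tendsto.div (h1 z hz) (Or.inr (spectrumMass_ne_zero hμ hz.1)) (h2 z hz)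
    (Or.inl (spectrumMass_ne_top hμ hz.2))

/-- At `0` this is the defining property of the limsup; elsewhere it is continuity of `R`. -/
lemma upperSemicontinuousOn_ratioExt {a : ℝ} (ha : ContinuousOn (ratio P ξ μ) (Ioc 0 a)) :
    UpperSemicontinuousOn (ratioExt P ξ μ) (Icc 0 a) := by
  intro z₀ hz₀ y hy
  rcases hz₀.1.eq_or_lt with rfl | hpos
  -- Near `0` within `[0, a]` there are only the point itself and the right-hand punctured
  -- neighbourhood, handled separately.
  · have hle : 𝓝[Icc 0 a] (0 : ℝ) ≤ pure 0 ⊔ 𝓝[>] 0 := by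
      rw [← nhdsWithin_insert, Ioi_insert]
      exact nhdsWithin_mono _ Icc_subset_Ici_self
    refine hle (eventually_sup.2 ⟨hy, ?_⟩)
    rw [ratioExt, if_pos rfl] at hy
    filter_upwards [eventually_lt_of_limsup_lt hy, self_mem_nhdsWithin] with z h1 h2
    rwa [ratioExt, if_neg (ne_of_gt h2)]
  · rw [ratioExt, if_neg hpos.ne'] at hy
    have hnear : ∀ᶠ z in 𝓝[Icc 0 a] z₀, 0 < z :=
      mem_nhdsWithin_of_mem_nhds (lt_mem_nhds hpos)
    have hle : 𝓝[Icc 0 a] z₀ ≤ 𝓝[Ioc 0 a] z₀ := by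
      refine le_inf inf_le_left (le_principal_iff.2 ?_)
      filter_upwards [hnear, self_mem_nhdsWithin] with z h1 h2 using ⟨h1, h2.2⟩
    have hcont := (ha z₀ ⟨hpos, hz₀.2⟩).mono_left hle
    filter_upwards [(tendsto_order.1 hcont).2 y hy, hnear] with z h1 h2
    rwa [ratioExt, if_neg h2.ne']

lemma ratioExt_le_iSup {a : ℝ} (ha : 0 < a) {z : ℝ} (hz : z ∈ Icc 0 a) :
    ratioExt P ξ μ z ≤ ⨆ z ∈ Ioc 0 a, ratio P ξ μ z := by
  rcases hz.1.eq_or_lt with rfl | hpos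
  · rw [ratioExt, if_pos rfl]
    refine limsup_le_of_le (by isBoundedDefault) ?_
    filter_upwards [Ioc_mem_nhdsGT ha] with z hz'
    exact le_iSup₂ (f := fun z (_ : z ∈ Ioc 0 a) => ratio P ξ μ z) z hz'
  · rw [ratioExt, if_neg hpos.ne']
    exact le_iSup₂ (f := fun z (_ : z ∈ Ioc 0 a) => ratio P ξ μ z) z ⟨hpos, hz.2⟩

lemma Delta_eq_neg_iSup (hξ : Measurable ξ) (hnn : ∀ᵐ ω ∂P, 0 ≤ ξ ω) (hint : Integrable ξ P)
    (hna : ∀ x : ℝ, P {ω | ξ ω = x} = 0) (hμ : μ (Ioc 0 1)ᶜ = 0) {ρ₀ : ℝ} (hρ₀ : 0 < ρ₀)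
    {c : ℝ} (hc : 0 < tailProb P ξ c) :
    Delta P ξ μ ρ₀ c =
      -((ρ₀ : EReal) * ((⨆ z ∈ Ioc 0 (tailProb P ξ c), ratio P ξ μ z : ℝ≥0∞) : EReal)) := by
  have hcoe : ∀ x : ℝ≥0∞,
      (ρ₀ : EReal) * (x : EReal) = ((ENNReal.ofReal ρ₀ * x : ℝ≥0∞) : EReal) := by
    intro x
    rw [EReal.coe_ennreal_mul, EReal.coe_ennreal_ofReal, max_eq_left hρ₀.le]
  have hub : ∀ z ∈ Ioc 0 (tailProb P ξ c),
      ((ENNReal.ofReal ρ₀ * ratio P ξ μ z : ℝ≥0∞) : EReal) ≤ -Delta P ξ μ ρ₀ c := by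
    intro z hz
    rw [← hcoe, EReal.le_neg]
    exact Delta_le_neg_ratio hξ hnn hint hna hμ hρ₀ hz.1 hz.2
  have hpos : 0 ≤ -Delta P ξ μ ρ₀ c :=
    (EReal.coe_ennreal_nonneg _).trans (hub _ ⟨hc, le_rfl⟩)
  refine le_antisymm ?_ (neg_le_Delta hξ hnn hna hμ hρ₀ fun z hz =>
    le_iSup₂ (f := fun z (_ : z ∈ Ioc 0 (tailProb P ξ c)) => ratio P ξ μ z) z hz)
  -- As `-Δ(c) ≥ 0`, the comparison moves to `ℝ≥0∞`, where multiplication commutes with suprema.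
  rw [EReal.le_neg, hcoe, ← EReal.coe_toENNReal hpos, EReal.coe_ennreal_le_coe_ennreal_iff]
  simp only [ENNReal.mul_iSup]
  refine iSup₂_le fun z hz => ?_
  rw [← EReal.toENNReal_coe (x := ENNReal.ofReal ρ₀ * ratio P ξ μ z)]
  exact EReal.toENNReal_le_toENNReal (hub z hz)

lemma quantile_nonneg (hnn : ∀ᵐ ω ∂P, 0 ≤ ξ ω) {u : ℝ} (hu : 0 < u) : 0 ≤ quantile P ξ u := by
  refine le_iInf₂ fun x hx => ?_
  have hx' : u ≤ distFun P ξ x := hx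
  refine EReal.coe_nonneg.2 (not_lt.1 fun h => ?_)
  have : distFun P ξ x = 0 := by
    refine (measureReal_eq_zero_iff).2 (measure_eq_zero_iff_ae_notMem.2 ?_)
    filter_upwards [hnn] with ω hω
    exact not_le.2 (h.trans_le hω)
  linarith

lemma coe_ennreal_div {a b : ℝ≥0∞} (h0 : b ≠ 0) (ht : b ≠ ⊤) :
    ((a / b : ℝ≥0∞) : EReal) = (a : EReal) / (b : EReal) := by
  symm
  rw [EReal.div_eq_iff (by simp) (by simpa using ht) (by simpa using h0), ← EReal.coe_ennreal_mul,
    ENNReal.div_mul_cancel h0 ht]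

lemma tendsto_ratio (hξ : Measurable ξ) (hnn : ∀ᵐ ω ∂P, 0 ≤ ξ ω)
    (hna : ∀ x : ℝ, P {ω | ξ ω = x} = 0) (hμ : μ (Ioc 0 1)ᶜ = 0) {L : EReal}
    (hL : Tendsto (fun x : ℝ => quantile P ξ (1 - x) / (spectrumFun μ x : EReal)) (𝓝[>] 0) (𝓝 L)) :
    0 ≤ L ∧ Tendsto (ratio P ξ μ) (𝓝[>] 0) (𝓝 L.toENNReal) := by
  have h01 : Ioo (0 : ℝ) 1 ∈ 𝓝[>] 0 := Ioo_mem_nhdsGT one_pos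
  have hφ0 := eventually_spectrumFun_ne_zero hμ
  have hφt : ∀ᶠ x in 𝓝[>] 0, spectrumFun μ x ≠ ⊤ := by
    filter_upwards [self_mem_nhdsWithin] with x hx using spectrumFun_ne_top hx
  -- For small `x > 0` the spectrum is neither `0` nor `∞` and the quantile is nonnegative, so
  -- division in `EReal` agrees with division in `ℝ≥0∞`.
  have hcoe : ∀ᶠ x in 𝓝[>] 0, quantile P ξ (1 - x) / (spectrumFun μ x : EReal) =
      (((quantile P ξ (1 - x)).toENNReal / spectrumFun μ x : ℝ≥0∞) : EReal) := by
    filter_upwards [h01, hφ0, hφt] with x hx h0 ht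
    rw [coe_ennreal_div h0 ht,
      EReal.coe_toENNReal (quantile_nonneg hnn (by linarith [hx.2]))]
  have hL' := hL.congr' hcoe
  refine ⟨ge_of_tendsto hL' (Eventually.of_forall fun x => EReal.coe_ennreal_nonneg _), ?_⟩
  have hq := (EReal.continuous_toENNReal.tendsto L).comp hL'
  simp only [Function.comp_def, EReal.toENNReal_coe] at hq
  have hG0 : ∀ᶠ z in 𝓝[>] (0 : ℝ), ∫⁻ u in Ioc 0 z, spectrumFun μ u ≠ 0 := by
    filter_upwards [self_mem_nhdsWithin] with z hz using spectrumMass_ne_zero hμ hz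
  have hGt : ∀ᶠ z in 𝓝[>] (0 : ℝ), ∫⁻ u in Ioc 0 z, spectrumFun μ u ≠ ⊤ := by
    filter_upwards [h01] with z hz using spectrumMass_ne_top hμ hz.2.le
  refine (tendsto_setLIntegral_div (spectrumFun_anti μ).measurable hφ0 hφt hG0 hGt hq).congr' ?_
  filter_upwards [h01] with z hz
  exact (ratio_eq_quantile hξ hnn hna hz.1 hz.2.le).symm

end Main

end SpectralPortfolio

theorem corollary4p2 {Ω : Type*} [MeasurableSpace Ω] (P : Measure Ω) [IsProbabilityMeasure P]
    (ξ : Ω → ℝ) (hξ_meas : Measurable ξ) (hξ_nonneg : ∀ᵐ ω ∂P, 0 ≤ ξ ω)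
    (hξ_int : ∫ ω, ξ ω ∂P = 1) (hξ_noatom : ∀ x : ℝ, P {ω | ξ ω = x} = 0)
    (μ : Measure ℝ) [IsProbabilityMeasure μ] (hμ : μ (Ioc 0 1)ᶜ = 0)
    (ρ₀ : ℝ) (hρ₀ : 0 < ρ₀) :
    (∀ c : ℝ, (c : EReal) < SpectralPortfolio.essSupE P ξ →
      ∃ z₀ ∈ Icc 0 (SpectralPortfolio.tailProb P ξ c),
        IsMaxOn (SpectralPortfolio.ratioExt P ξ μ)
          (Icc 0 (SpectralPortfolio.tailProb P ξ c)) z₀ ∧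
        SpectralPortfolio.Delta P ξ μ ρ₀ c =
          -((ρ₀ : EReal) * (SpectralPortfolio.ratioExt P ξ μ z₀ : EReal))) ∧
    (∀ L : EReal,
      Tendsto (fun x : ℝ => SpectralPortfolio.quantile P ξ (1 - x) /
        (SpectralPortfolio.spectrumFun μ x : EReal)) (𝓝[>] 0) (𝓝 L) →
      Tendsto (fun c : ℝ => SpectralPortfolio.Delta P ξ μ ρ₀ c)
        (comap (fun c : ℝ => (c : EReal)) (𝓝[<] SpectralPortfolio.essSupE P ξ))
        (𝓝 (-((ρ₀ : EReal) * L)))) := by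
  open SpectralPortfolio in
  have hint : Integrable ξ P := integrable_of_integral_eq_one hξ_int
  refine ⟨fun c hc => ?_, fun L hL => ?_⟩
  · have hpos := tailProb_pos_of_lt_essSupE hc
    have hcont := (continuousOn_ratio hξ_meas hξ_nonneg hint hξ_noatom hμ).mono
      (Ioc_subset_Ioc_right (measureReal_le_one : tailProb P ξ c ≤ 1))
    obtain ⟨z₀, hz₀, hmax⟩ := (upperSemicontinuousOn_ratioExt hcont).exists_isMaxOn
      (nonempty_Icc.2 hpos.le) isCompact_Icc
    refine ⟨z₀, hz₀, hmax, ?_⟩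
    rw [Delta_eq_neg_iSup hξ_meas hξ_nonneg hint hξ_noatom hμ hρ₀ hpos]
    congr 3
    -- The maximum over `[0, α(c)]` equals the supremum over `(0, α(c)]`: the added value at `0` is
    -- a limsup of the others.
    refine le_antisymm (iSup₂_le fun z hz => ?_) (ratioExt_le_iSup hpos hz₀)
    have h : ratioExt P ξ μ z ≤ ratioExt P ξ μ z₀ := hmax ⟨hz.1.le, hz.2⟩
    rwa [ratioExt, if_neg hz.1.ne'] at h
  · obtain ⟨hL0, hR⟩ := tendsto_ratio hξ_meas hξ_nonneg hξ_noatom hμ hL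
    have hcoe : ∀ x : ℝ≥0∞,
        (ρ₀ : EReal) * (x : EReal) = ((ENNReal.ofReal ρ₀ * x : ℝ≥0∞) : EReal) := fun x => by
      rw [EReal.coe_ennreal_mul, EReal.coe_ennreal_ofReal, max_eq_left hρ₀.le]
    -- The supremum of `R` over `(0, a]` tends to the limit of `R` at `0⁺`; substitute `a = α(c)`.
    have hsup := (tendsto_iSup_Ioc hR).comp (tendsto_tailProb (P := P) hξ_meas hξ_noatom)
    have hmul := ENNReal.Tendsto.const_mul hsup
      (Or.inr (ENNReal.ofReal_ne_top : ENNReal.ofReal ρ₀ ≠ ⊤))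
    have hneg := ((continuous_coe_ennreal_ereal.tendsto _).comp hmul).neg
    rw [← hcoe, EReal.coe_toENNReal hL0] at hneg
    refine hneg.congr' ?_
    have hev : ∀ᶠ x in 𝓝[<] essSupE P ξ, x < essSupE P ξ := self_mem_nhdsWithin
    filter_upwards [hev.comap _] with c hc
    rw [Delta_eq_neg_iSup hξ_meas hξ_nonneg hint hξ_noatom hμ hρ₀ (tailProb_pos_of_lt_essSupE hc),
      hcoe]
    rfl
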